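/- Let $K$ be an algebraically closed field of characteristic zero and let $n\ge m\ge 2$ and $d$ be integers with $n+1\le\binom{d+m-2}{m-1}$. A Perazzo form of degree $d$ is a form $$F=X_0p_0+\dots+X_np_n+G\in K[X_0,\dots,X_n,U_1,\dots,U_m]$$ where $p_0,\dots,p_n\in K[U_1,\dots,U_m]_{d-1}$ are linearly independent but algebraically dependent over $K$, and $G\in K[U_1,\dots,U_m]_d$. Let $R=K[x_0,\dots,x_n,u_1,\dots,u_m]$ act on $K[X_0,\dots,X_n,U_1,\dots,U_m]$ by differentiation ($x_j=\partial/\partial X_j$, $u_k=\partial/\partial U_k$), and let $A_F=R/\operatorname{Ann}_R(F)$, $\operatorname{Ann}_R(F)=\{\phi\in R:\phi\circ F=0\}$, be the Perazzo algebra of $F$, with $h$-vector $(h_0,\dots,h_d)$, $h_i=\dim_K(A_F)_i$. Put $$\alpha_i=\binom{m+i-1}{m-1},\qquad \beta_i=\binom{d+m-i-1}{m-1},\qquad \gamma_i=(n+1)\binom{m+i-2}{m-1}.$$ Then, among the $h$-vectors of all Perazzo algebras $A_F$ with these $n,m,d$, there is a componentwise maximum $h_{\max}=(h_0,\dots,h_d)$.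 It is given by $$h_i=h_{d-i}=\min\{\alpha_i+\beta_i,\ \alpha_i+\gamma_i\}\qquad\text{for } 0\le i\le\lfloor d/2\rfloor .$$ Moreover it is attained when $p_0,\dots,p_n$ and $G$ are general: there is a nonempty Zariski open subset of $(K[U_1,\dots,U_m]_{d-1})^{n+1}\times K[U_1,\dots,U_m]_d$ such that, for every $(p_0,\dots,p_n,G)$ in it, $F=X_0p_0+\dots+X_np_n+G$ is a Perazzo form and the $h$-vector of $A_F$ is $h_{\max}$. -/

import Mathlib

open MvPolynomial

noncomputable section

namespace Perazzo

/-- The partial derivative with respect to the variable `i`, as a linear endomorphism of the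
polynomial ring. -/
def partialEnd (K : Type*) {σ : Type*} [Field K] (i : σ) : Module.End K (MvPolynomial σ K) :=
  (pderiv i).toLinearMap

theorem partialEnd_comm (K : Type*) {σ : Type*} [Field K] (i j : σ) :
    partialEnd K i * partialEnd K j = partialEnd K j * partialEnd K i := by
  have h : ⁅(pderiv i : Derivation K (MvPolynomial σ K) (MvPolynomial σ K)),
      (pderiv j : Derivation K (MvPolynomial σ K) (MvPolynomial σ K))⁆ = 0 := by
    classical
    refine MvPolynomial.derivation_ext fun k => ?_
    rw [Derivation.commutator_apply]
    simp only [pderiv_X, Derivation.zero_apply]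
    simp only [Pi.single_apply]
    split_ifs <;> simp
  refine LinearMap.ext fun f => ?_
  have h2 := congrArg (fun D : Derivation K (MvPolynomial σ K) (MvPolynomial σ K) => D f) h
  simp only [Derivation.commutator_apply, Derivation.zero_apply] at h2
  exact sub_eq_zero.mp h2

/-- The commutative algebra of differential operators with constant coefficients. -/
abbrev constCoeffOps (K : Type*) (σ : Type*) [Field K] :
    Subalgebra K (Module.End K (MvPolynomial σ K)) :=
  Algebra.adjoin K (Set.range (partialEnd K (σ := σ)))

instance constCoeffOps_comm (K : Type*) (σ : Type*) [Field K] :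
    IsMulCommutative (constCoeffOps K σ) :=
  Algebra.isMulCommutative_adjoin K (by
    rintro _ ⟨i, rfl⟩ _ ⟨j, rfl⟩
    exact partialEnd_comm K i j)

open scoped IsMulCommutative in
/-- The action of `R = K[x_i]` on `S = K[X_i]` by differentiation: the algebra homomorphism from
`R` to the linear endomorphisms of `S` that sends `x_i` to `∂/∂X_i`. -/
def diffOp (K : Type*) (σ : Type*) [Field K] :
    MvPolynomial σ K →ₐ[K] Module.End K (MvPolynomial σ K) :=
  (constCoeffOps K σ).val.comp
    (aeval fun i => (⟨partialEnd K i, Algebra.subset_adjoin ⟨i, rfl⟩⟩ : constCoeffOps K σ))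

open scoped IsMulCommutative in
theorem diffOp_X (K : Type*) {σ : Type*} [Field K] (i : σ) (F : MvPolynomial σ K) :
    diffOp K σ (X i) F = pderiv i F := by
  simp [diffOp, partialEnd]

/-- `Ann F = {p ∈ R | p ∘ F = 0}`. -/
def annIdeal {K σ : Type*} [Field K] (F : MvPolynomial σ K) : Ideal (MvPolynomial σ K) where
  carrier := {p | diffOp K σ p F = 0}
  zero_mem' := by simp
  add_mem' := by
    intro a b ha hb
    simp only [Set.mem_ofPred_eq] at ha hb ⊢
    simp [ha, hb]
  smul_mem' := by
    intro c a ha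
    simp only [Set.mem_ofPred_eq] at ha ⊢
    simp [ha]

/-- The algebra `A_F = R / Ann F` with Macaulay dual generator `F`. -/
abbrev macaulayAlgebra {K σ : Type*} [Field K] (F : MvPolynomial σ K) : Type _ :=
  MvPolynomial σ K ⧸ annIdeal F

/-- The degree `i` component of `A_F`: the image of the forms of degree `i` of `R`. -/
def gradedPiece {K σ : Type*} [Field K] (F : MvPolynomial σ K) (i : ℕ) :
    Submodule K (macaulayAlgebra F) :=
  (homogeneousSubmodule σ K i).map (Ideal.Quotient.mkₐ K (annIdeal F)).toLinearMap

/-- The Hilbert function (the `h`-vector) of `A_F`: `h_i = dim_K (A_F)_i`. -/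
def hVector {K σ : Type*} [Field K] (F : MvPolynomial σ K) (i : ℕ) : ℕ :=
  Module.finrank K (gradedPiece F i)

/-- The polynomial `X_0 p_0 + ⋯ + X_n p_n + G`. The variables `X_0, …, X_n` are indexed by the left
summand of `Fin (n + 1) ⊕ Fin m`, the variables `U_1, …, U_m` by the right one. -/
def assemble {K : Type*} [Field K] {n m : ℕ} (p : Fin (n + 1) → MvPolynomial (Fin m) K)
    (G : MvPolynomial (Fin m) K) : MvPolynomial (Fin (n + 1) ⊕ Fin m) K :=
  ∑ j, X (Sum.inl j) * rename Sum.inr (p j) + rename Sum.inr G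

/-- `F` is a Perazzo form of degree `d`: it is `X_0 p_0 + ⋯ + X_n p_n + G` with forms `p_j` of
degree `d - 1` and `G` of degree `d` in the variables `U`, where the `p_j` are linearly independent
but algebraically dependent. -/
def IsPerazzoForm {K : Type*} [Field K] {n m : ℕ} (d : ℕ)
    (F : MvPolynomial (Fin (n + 1) ⊕ Fin m) K) : Prop :=
  ∃ (p : Fin (n + 1) → MvPolynomial (Fin m) K) (G : MvPolynomial (Fin m) K),
    (∀ j, (p j).IsHomogeneous (d - 1)) ∧ G.IsHomogeneous d ∧
    LinearIndependent K p ∧ ¬ AlgebraicIndependent K p ∧ F = assemble p G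

/-- The exponents of the monomials of degree `k` in `m` variables. -/
abbrev Exponents (m k : ℕ) : Type := {e : Fin m →₀ ℕ // e.degree = k}

/-- The coordinates of `(p_0, …, p_n, G)` in the affine space
`(K[U]_{d-1})^{n+1} × K[U]_d`. -/
def coefficients {K : Type*} [Field K] {n m : ℕ} (d : ℕ)
    (p : Fin (n + 1) → MvPolynomial (Fin m) K) (G : MvPolynomial (Fin m) K) :
    (Fin (n + 1) × Exponents m (d - 1)) ⊕ Exponents m d → K :=
  Sum.elim (fun x => coeff x.2.1 (p x.1)) (fun e => coeff e.1 G)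

/-- `P` holds for general forms `p_0, …, p_n` of degree `d - 1` and `G` of degree `d` in `m`
variables, that is, on a nonempty Zariski open subset of `(K[U]_{d-1})^{n+1} × K[U]_d`. As every
nonempty open subset of an affine space contains the nonvanishing locus of some nonzero polynomial,
only open subsets of this kind are considered. -/
def HoldsForGeneral {K : Type*} [Field K] {n m : ℕ} (d : ℕ)
    (P : (Fin (n + 1) → MvPolynomial (Fin m) K) → MvPolynomial (Fin m) K → Prop) : Prop :=
  ∃ Φ : MvPolynomial ((Fin (n + 1) × Exponents m (d - 1)) ⊕ Exponents m d) K, Φ ≠ 0 ∧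
    ∀ (p : Fin (n + 1) → MvPolynomial (Fin m) K) (G : MvPolynomial (Fin m) K),
      (∀ j, (p j).IsHomogeneous (d - 1)) → G.IsHomogeneous d →
      eval (coefficients d p G) Φ ≠ 0 → P p G

/-- `α_i = C(m + i - 1, m - 1)`. -/
def alpha (m i : ℕ) : ℕ := (m + i - 1).choose (m - 1)

/-- `β_i = C(d + m - i - 1, m - 1)`. -/
def beta (m d i : ℕ) : ℕ := (d + m - i - 1).choose (m - 1)

/-- `γ_i = (n + 1) C(m + i - 2, m - 1)`. -/
def gamma (n m i : ℕ) : ℕ := (n + 1) * (m + i - 2).choose (m - 1)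

/-- The vector with entries `min (α_i + β_i) (α_i + γ_i)` for `0 ≤ i ≤ ⌊d/2⌋`, extended to
`0 ≤ i ≤ d` by the symmetry `h_i = h_{d-i}`, and by zero beyond the socle degree `d`. -/
def hMax (n m d i : ℕ) : ℕ :=
  if i ≤ d / 2 then min (alpha m i + beta m d i) (alpha m i + gamma n m i)
  else if i ≤ d then
    min (alpha m (d - i) + beta m d (d - i)) (alpha m (d - i) + gamma n m (d - i))
  else 0

end Perazzo

end

/-!
The Hilbert function of `A_F` is read off from catalecticant matrices: in divided power coordinates
`q(a) = a! · coeff a F`, the number `h_i` is the rank of the Hankel matrix `(e, c) ↦ q (e + c)`, with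
`|e| = i` and `|c| = d - i` (`hVector_eq_rank`). Transposition gives `h_i = h_{d-i}`, so only
`i ≤ d / 2` matters.

For `F = ∑ X_j p_j + G`, which is of degree one in the variables `X`, the nonzero part of this matrix
has the block form `(* M; N 0)`. The `α_i` rows through `M` belong to monomials in `U`; the matrix `N`
has `γ_i` rows and `β_i` columns. This gives the upper bound `h_i ≤ α_i + min(β_i, γ_i)`
(`rank_catalecticant_le`) for every choice of `p` and `G`, and equality holds if `M` has independent
rows and `N` has maximal rank.

Having rank at least a given number is an open condition (`holdsForGeneral_le_rank`), so it suffices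
to give one example for each `i ≤ d / 2`. Let `p_j` be a sum of `(d - 1)`-st powers of as many linear
forms as there are monomials of degree `i - 1`, where the coefficient vectors of all these linear
forms are successive powers of a vector of distinct primes. Then `M` and `N` are products of
Vandermonde matrices and block diagonal matrices of Vandermonde blocks, whose nodes are the values of
monomials at the vector of primes (`linearIndependent_sum_pow_left`,
`linearIndependent_sum_pow_right`). These nodes are distinct by unique factorization, so both ranks
are maximal. For `M` this uses that `n + 1` times the number of monomials of degree `i - 1` is at
least `α_i`, which follows from `m ≤ n`.

Linear independence of the `p_j` is an open condition too, and it is met because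
`n + 1 ≤ dim K[U]_{d-1}`. Algebraic dependence is automatic: there are more than `m` of the `p_j`.
-/

noncomputable section

namespace Perazzo

/-! ### Catalecticant matrices compute the Hilbert function -/

instance fintypeDegreeEq (σ : Type*) [Finite σ] (k : ℕ) : Fintype {e : σ →₀ ℕ // e.degree = k} :=
  (Finsupp.finite_of_degree_eq (σ := σ) k).fintype

section Catalecticant

variable {K σ : Type*} [Field K]

theorem finrank_map_eq_of_ker_eq {V W W' : Type*} [AddCommGroup V] [AddCommGroup W]
    [AddCommGroup W'] [Module K V] [Module K W] [Module K W'] (S : Submodule K V)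
    (f : V →ₗ[K] W) (g : V →ₗ[K] W') (h : ∀ v ∈ S, f v = 0 ↔ g v = 0) :
    Module.finrank K (S.map f) = Module.finrank K (S.map g) := by
  have hk : LinearMap.ker (f.domRestrict S) = LinearMap.ker (g.domRestrict S) := by
    ext v
    simpa using h v.1 v.2
  rw [← LinearMap.range_domRestrict, ← LinearMap.range_domRestrict,
    ← (f.domRestrict S).quotKerEquivRange.finrank_eq,
    ← (g.domRestrict S).quotKerEquivRange.finrank_eq, hk]

theorem mk_eq_zero_iff {F φ : MvPolynomial σ K} :
    (Ideal.Quotient.mkₐ K (annIdeal F)).toLinearMap φ = 0 ↔ diffOp K σ φ F = 0 := by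
  simp only [AlgHom.toLinearMap_apply, Ideal.Quotient.mkₐ_eq_mk]
  exact Ideal.Quotient.eq_zero_iff_mem

theorem degree_eq_of_mem_support {i : ℕ} {φ : MvPolynomial σ K} (hφ : φ.IsHomogeneous i)
    {e : σ →₀ ℕ} (he : e ∈ φ.support) : e.degree = i := by
  by_contra h
  exact mem_support_iff.mp he (hφ.coeff_eq_zero h)

variable [Fintype σ]

/-- The coefficients of `F` in the basis of divided powers: `a ↦ a! · coeff a F`. In these coordinates
`∂/∂X_i` shifts the exponent without a numerical factor, see `dividedCoeff_pderiv`. -/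
def dividedCoeff : MvPolynomial σ K →ₗ[K] ((σ →₀ ℕ) → K) where
  toFun F a := ((∏ s, (a s).factorial : ℕ) : K) * coeff a F
  map_add' F G := by ext a; simp [mul_add]
  map_smul' c F := by ext a; simp [mul_left_comm]

theorem dividedCoeff_apply (F : MvPolynomial σ K) (a : σ →₀ ℕ) :
    dividedCoeff F a = ((∏ s, (a s).factorial : ℕ) : K) * coeff a F := rfl

theorem dividedCoeff_eq_zero_iff [CharZero K] {F : MvPolynomial σ K} {a : σ →₀ ℕ} :
    dividedCoeff F a = 0 ↔ coeff a F = 0 := by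
  rw [dividedCoeff_apply, mul_eq_zero, or_iff_right]
  exact_mod_cast Finset.prod_ne_zero_iff.mpr fun s _ => (a s).factorial_ne_zero

theorem dividedCoeff_pderiv (i : σ) (F : MvPolynomial σ K) (a : σ →₀ ℕ) :
    dividedCoeff (pderiv i F) a = dividedCoeff F (Finsupp.single i 1 + a) := by
  classical
  have h : ∏ s, ((Finsupp.single i 1 + a : σ →₀ ℕ) s).factorial =
      (a i + 1) * ∏ s, (a s).factorial := by
    rw [← Finset.mul_prod_erase _ _ (Finset.mem_univ i),
      ← Finset.mul_prod_erase _ (fun s => (a s).factorial) (Finset.mem_univ i), ← mul_assoc]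
    congr 1
    · simp [add_comm 1, Nat.factorial_succ]
    · refine Finset.prod_congr rfl fun s hs => ?_
      simp [Finsupp.single_eq_of_ne (Finset.ne_of_mem_erase hs)]
  rw [dividedCoeff_apply, dividedCoeff_apply, coeff_pderiv, h, add_comm a]
  push_cast
  ring

theorem dividedCoeff_diffOp_monomial (e : σ →₀ ℕ) (F : MvPolynomial σ K) (a : σ →₀ ℕ) :
    dividedCoeff (diffOp K σ (monomial e 1) F) a = dividedCoeff F (e + a) := by
  induction e using Finsupp.induction_linear generalizing F a with
  | zero => simp
  | add e f he hf =>
    rw [← one_mul (1 : K), ← monomial_mul, map_mul, Module.End.mul_apply, he, hf, add_left_comm,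
      add_assoc]
  | single i k =>
    rw [← X_pow_eq_monomial]
    induction k generalizing F a with
    | zero => simp
    | succ k ih =>
      rw [pow_succ, map_mul, Module.End.mul_apply, ih, diffOp_X, dividedCoeff_pderiv,
        Finsupp.single_add, add_left_comm, add_assoc]

theorem dividedCoeff_diffOp (φ F : MvPolynomial σ K) (a : σ →₀ ℕ) :
    dividedCoeff (diffOp K σ φ F) a = ∑ e ∈ φ.support, coeff e φ * dividedCoeff F (e + a) := by
  conv_lhs => rw [φ.as_sum]
  rw [map_sum, LinearMap.sum_apply, map_sum, Finset.sum_apply]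
  refine Finset.sum_congr rfl fun e _ => ?_
  rw [← mul_one (coeff e φ), ← smul_eq_mul, ← smul_monomial, map_smul, LinearMap.smul_apply,
    map_smul, Pi.smul_apply, dividedCoeff_diffOp_monomial]
  simp

theorem dividedCoeff_eq_zero_of_degree_ne {d : ℕ} {F : MvPolynomial σ K} (hF : F.IsHomogeneous d)
    {a : σ →₀ ℕ} (ha : a.degree ≠ d) : dividedCoeff F a = 0 := by
  rw [dividedCoeff_apply, hF.coeff_eq_zero ha, mul_zero]

/-- The catalecticant matrix of `F` of degrees `(i, j)`. The entry at the monomials `e` and `c` is the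
coefficient of `F` at `e + c` in the basis of divided powers; up to a diagonal factor,
invertible in characteristic zero, this is the matrix of the map from forms of degree `i` to forms
of degree `j` given by applying differential operators to `F`. -/
def catalecticant (F : MvPolynomial σ K) (i j : ℕ) :
    Matrix {e : σ →₀ ℕ // e.degree = i} {e : σ →₀ ℕ // e.degree = j} K :=
  Matrix.of fun e c => dividedCoeff F (e.1 + c.1)

theorem catalecticant_apply (F : MvPolynomial σ K) (i j : ℕ)
    (e : {e : σ →₀ ℕ // e.degree = i}) (c : {e : σ →₀ ℕ // e.degree = j}) :
    catalecticant F i j e c = dividedCoeff F (e.1 + c.1) := rfl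

theorem catalecticant_transpose (F : MvPolynomial σ K) (i j : ℕ) :
    (catalecticant F i j).transpose = catalecticant F j i := by
  ext e c
  simp [catalecticant, add_comm]

theorem dividedCoeff_diffOp_eq_zero {d i : ℕ} {φ F : MvPolynomial σ K} (hF : F.IsHomogeneous d)
    (hφ : φ.IsHomogeneous i) {a : σ →₀ ℕ} (ha : i + a.degree ≠ d) :
    dividedCoeff (diffOp K σ φ F) a = 0 := by
  rw [dividedCoeff_diffOp]
  refine Finset.sum_eq_zero fun e he => ?_
  rw [dividedCoeff_eq_zero_of_degree_ne hF, mul_zero]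
  rw [map_add]
  have := degree_eq_of_mem_support hφ he
  omega

theorem hVector_eq_rank [CharZero K] {d : ℕ} {F : MvPolynomial σ K} (hF : F.IsHomogeneous d)
    {i j : ℕ} (hij : i + j = d) : hVector F i = (catalecticant F i j).rank := by
  let L : MvPolynomial σ K →ₗ[K] ({e : σ →₀ ℕ // e.degree = j} → K) :=
    (LinearMap.funLeft K K Subtype.val) ∘ₗ dividedCoeff ∘ₗ (LinearMap.applyₗ F) ∘ₗ
      (diffOp K σ).toLinearMap
  have hL (φ c) : L φ c = dividedCoeff (diffOp K σ φ F) c.1 := rfl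
  rw [hVector, gradedPiece, finrank_map_eq_of_ker_eq _ _ L, Matrix.rank_eq_finrank_span_row]
  · suffices h : (homogeneousSubmodule σ K i).map L =
        Submodule.span K (Set.range (catalecticant F i j).row) by rw [h]
    apply le_antisymm
    · rintro _ ⟨φ, hφ, rfl⟩
      have : L φ = ∑ e ∈ φ.support.attach, coeff e.1 φ •
          (catalecticant F i j).row ⟨e.1, degree_eq_of_mem_support hφ e.2⟩ := by
        ext c
        rw [hL, dividedCoeff_diffOp, ← Finset.sum_attach, Finset.sum_apply]
        rfl
      rw [this]
      exact Submodule.sum_mem _ fun e _ => Submodule.smul_mem _ _ (Submodule.subset_span ⟨_, rfl⟩)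
    · rw [Submodule.span_le]
      rintro _ ⟨e, rfl⟩
      refine ⟨monomial e.1 1, isHomogeneous_monomial _ e.2, ?_⟩
      ext c
      rw [hL, dividedCoeff_diffOp_monomial]
      rfl
  · intro φ hφ
    rw [mk_eq_zero_iff]
    constructor
    · intro h
      ext c
      rw [hL, h]
      simp
    · intro h
      ext a
      rw [coeff_zero, ← dividedCoeff_eq_zero_iff]
      by_cases ha : a.degree = j
      · exact congrFun h ⟨a, ha⟩
      · exact dividedCoeff_diffOp_eq_zero hF hφ (by omega)

theorem hVector_eq_zero [CharZero K] {d : ℕ} {F : MvPolynomial σ K} (hF : F.IsHomogeneous d)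
    {i : ℕ} (hi : d < i) : hVector F i = 0 := by
  rw [hVector, gradedPiece, finrank_map_eq_of_ker_eq _ _ (0 : _ →ₗ[K] K)]
  · simp
  · intro φ hφ
    rw [mk_eq_zero_iff]
    simp only [LinearMap.zero_apply, iff_true]
    ext a
    rw [coeff_zero, ← dividedCoeff_eq_zero_iff]
    exact dividedCoeff_diffOp_eq_zero hF hφ (by omega)

/-- The symmetry of the Hilbert function of a graded Gorenstein algebra, here as invariance of the
rank under transposition. -/
theorem hVector_symm [CharZero K] {d : ℕ} {F : MvPolynomial σ K} (hF : F.IsHomogeneous d)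
    {i j : ℕ} (hij : i + j = d) : hVector F i = hVector F j := by
  rw [hVector_eq_rank hF hij, hVector_eq_rank hF ((add_comm j i).trans hij),
    ← catalecticant_transpose, Matrix.rank_transpose]

end Catalecticant

/-! ### Ranks of matrices: minors, sums and blocks -/

section Rank
variable {K : Type*} [Field K]

theorem exists_linearIndependent_rows {R C : Type*} [Finite R] [Fintype C]
    (A : Matrix R C K) {k : ℕ} (hk : k ≤ A.rank) :
    ∃ f : Fin k → R, LinearIndependent K (A.submatrix f id).row := by
  rw [Matrix.rank_eq_finrank_span_row] at hk
  obtain ⟨v, hv, -, hli⟩ := Submodule.exists_fun_fin_finrank_span_eq K (Set.range A.row)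
  choose f hf using hv
  refine ⟨fun t => f (Fin.castLE hk t), ?_⟩
  have h : (A.submatrix (fun t => f (Fin.castLE hk t)) id).row = v ∘ Fin.castLE hk :=
    funext fun t => hf _
  rw [h]
  exact hli.comp _ (Fin.castLE_injective hk)

theorem exists_det_submatrix_ne_zero {R C : Type*} [Finite R] [Fintype C]
    (A : Matrix R C K) {k : ℕ} (hk : k ≤ A.rank) :
    ∃ (f : Fin k → R) (g : Fin k → C), (A.submatrix f g).det ≠ 0 := by
  obtain ⟨f, hf⟩ := exists_linearIndependent_rows A hk
  have h2 : k ≤ (A.submatrix f id).transpose.rank := by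
    rw [Matrix.rank_transpose]
    simp [hf.rank_matrix]
  obtain ⟨g, hg⟩ := exists_linearIndependent_rows _ h2
  refine ⟨f, g, ?_⟩
  have h3 : IsUnit (A.submatrix f g).transpose := Matrix.linearIndependent_rows_iff_isUnit.mp hg
  rw [← Matrix.det_transpose]
  exact ((Matrix.isUnit_iff_isUnit_det _).mp h3).ne_zero

theorem le_rank_of_det_submatrix_ne_zero {R C : Type*} [Fintype C]
    (A : Matrix R C K) {k : ℕ} (f : Fin k → R) (g : Fin k → C)
    (h : (A.submatrix f g).det ≠ 0) : k ≤ A.rank := by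
  have := Matrix.rank_of_det_ne_zero h
  rw [Fintype.card_fin] at this
  rw [← this]
  exact Matrix.rank_submatrix_le A f g

/-- The rank of a matrix of polynomials is lower semicontinuous: if it is at least `k` at one point,
then a `k × k` minor is a nonzero polynomial, and the rank is at least `k` where it does not
vanish. -/
theorem exists_ne_zero_forall_le_rank {T R C : Type*} [Finite R] [Fintype C]
    (A : Matrix R C (MvPolynomial T K)) {k : ℕ} (v : T → K) (hk : k ≤ (A.map (eval v)).rank) :
    ∃ Φ : MvPolynomial T K, Φ ≠ 0 ∧ ∀ w, eval w Φ ≠ 0 → k ≤ (A.map (eval w)).rank := by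
  obtain ⟨f, g, h⟩ := exists_det_submatrix_ne_zero _ hk
  have hdet (w) : eval w (A.submatrix f g).det = ((A.map (eval w)).submatrix f g).det := by
    rw [RingHom.map_det]
    rfl
  refine ⟨(A.submatrix f g).det, fun h0 => h ?_, fun w hw => ?_⟩
  · rw [← hdet, h0, map_zero]
  · rw [hdet] at hw
    exact le_rank_of_det_submatrix_ne_zero _ f g hw

theorem rank_add_le {R C : Type*} [Finite R] [Fintype C] (A B : Matrix R C K) :
    (A + B).rank ≤ A.rank + B.rank := by
  rw [Matrix.rank, Matrix.rank, Matrix.rank, Matrix.mulVecLin_add]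
  exact (Submodule.finrank_mono (LinearMap.range_add_le _ _)).trans
    (Submodule.finrank_add_le_finrank_add_finrank _ _)

theorem rank_le_card_of_row_eq_zero {R C ι : Type*} [Finite R] [Fintype C] [Fintype ι]
    (A : Matrix R C K) (f : ι → R) (h : ∀ x, x ∉ Set.range f → A x = 0) :
    A.rank ≤ Fintype.card ι := by
  classical
  refine (A.rank_le_card_of_support_subset (Finset.univ.image f) ?_).trans Finset.card_image_le
  intro x hx
  by_contra hxf
  exact hx (h x (by simpa using hxf))

theorem rank_add_rank_le_rank_fromBlocks {R R' C C' : Type*} [Fintype R] [Fintype R']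
    [Fintype C] [Fintype C'] (G : Matrix R C K) (M : Matrix R C' K) (N : Matrix R' C K) :
    M.rank + N.rank ≤ (Matrix.fromBlocks G M N 0).rank := by
  obtain ⟨f, g, h⟩ := exists_det_submatrix_ne_zero M le_rfl
  obtain ⟨f', g', h'⟩ := exists_det_submatrix_ne_zero N le_rfl
  have := Matrix.rank_submatrix_le (Matrix.fromBlocks G M N 0) (Sum.map f f')
    (Sum.elim (Sum.inr ∘ g) (Sum.inl ∘ g'))
  refine le_trans (le_of_eq ?_) this
  have hE : (Matrix.fromBlocks G M N 0).submatrix (Sum.map f f')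
      (Sum.elim (Sum.inr ∘ g) (Sum.inl ∘ g')) =
      Matrix.fromBlocks (M.submatrix f g) (G.submatrix f g') 0 (N.submatrix f' g') := by
    ext (x | x) (y | y) <;> rfl
  rw [hE, Matrix.rank_of_det_ne_zero]
  · simp
  · rw [Matrix.det_fromBlocks_zero₂₁]
    exact mul_ne_zero h h'

end Rank

/-! ### Vandermonde systems and nodes for monomials -/

section Vandermonde
variable {K ι : Type*} [Field K] [Fintype ι]

theorem eq_zero_of_sum_mul_pow_eq_zero {w : ι → K} (hw : Function.Injective w)
    (hw0 : ∀ b, w b ≠ 0) (s r : ℕ) (hr : Fintype.card ι ≤ r) {x : ι → K}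
    (h : ∀ k < r, ∑ b, x b * w b ^ (s + k) = 0) : x = 0 := by
  have e := Fintype.equivFin ι
  have h0 := Matrix.eq_zero_of_forall_pow_sum_mul_pow_eq_zero (f := w ∘ e.symm)
    (v := fun t => x (e.symm t) * w (e.symm t) ^ s) (hw.comp e.symm.injective) (fun k => by
      rw [← h k (k.2.trans_le hr), ← e.symm.sum_comp]
      exact Finset.sum_congr rfl fun t _ => by simp [pow_add, mul_assoc])
  ext b
  have := congrFun h0 (e b)
  simpa [hw0] using this

theorem eq_zero_of_sum_fin_mul_pow_eq_zero {w : ι → K} (hw : Function.Injective w)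
    {r : ℕ} (hr : r ≤ Fintype.card ι) {y : Fin r → K}
    (h : ∀ c, ∑ k : Fin r, y k * w c ^ (k : ℕ) = 0) : y = 0 :=
  have e := Fintype.equivFin ι
  Matrix.eq_zero_of_forall_index_sum_mul_pow_eq_zero
    (hw.comp (e.symm.injective.comp (Fin.castLE_injective hr))) fun _ => h _

variable {κ : Type*} [Fintype κ] {u : ι → K} {v : κ → K}

/-- The matrix is the product of the Vandermonde matrix `u b ^ s`, with `s < N * r`, and a block
diagonal matrix whose blocks are the `N` Vandermonde matrices `v c ^ (k + r * j)`, with `k < r`.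
Both have independent rows. -/
theorem linearIndependent_sum_pow_left (hu : Function.Injective u) (hu0 : ∀ b, u b ≠ 0)
    (hv : Function.Injective v) (hv0 : ∀ c, v c ≠ 0) {N r : ℕ}
    (hι : Fintype.card ι ≤ N * r) (hκ : r ≤ Fintype.card κ) :
    LinearIndependent K (Matrix.of fun (b : ι) (x : Fin N × κ) =>
      ∑ k : Fin r, (u b * v x.2) ^ (k + r * x.1 : ℕ)).row := by
  rw [Fintype.linearIndependent_iff]
  intro x hx
  have h1 (j : Fin N) : (fun k : Fin r => ∑ b, x b * u b ^ (k + r * j : ℕ)) = 0 := by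
    refine eq_zero_of_sum_fin_mul_pow_eq_zero hv hκ fun c => ?_
    have h2 := congrFun hx (j, c)
    simp only [Finset.sum_apply, Pi.smul_apply, Matrix.row_apply, Matrix.of_apply, smul_eq_mul,
      Pi.zero_apply, Finset.mul_sum] at h2
    rw [Finset.sum_comm] at h2
    have h3 : v c ^ (r * j : ℕ) * ∑ k : Fin r, (∑ b, x b * u b ^ (k + r * j : ℕ)) * v c ^ (k : ℕ)
        = 0 := by
      rw [← h2, Finset.mul_sum]
      refine Finset.sum_congr rfl fun k _ => ?_
      rw [Finset.sum_mul, Finset.mul_sum]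
      refine Finset.sum_congr rfl fun b _ => ?_
      rw [mul_pow, pow_add (v c)]
      ring
    exact (mul_eq_zero.mp h3).resolve_left (pow_ne_zero _ (hv0 c))
  refine congrFun (eq_zero_of_sum_mul_pow_eq_zero hu hu0 0 (N * r) hι fun s hs => ?_)
  have h2 := congrFun (h1 (finProdFinEquiv.symm ⟨s, hs⟩).1) (finProdFinEquiv.symm ⟨s, hs⟩).2
  simpa [Nat.mod_add_div] using h2

/-- The same product as in `linearIndependent_sum_pow_left`, with the block diagonal factor on the
left. -/
theorem linearIndependent_sum_pow_right (hu : Function.Injective u) (hu0 : ∀ b, u b ≠ 0)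
    (hv : Function.Injective v) {N r : ℕ}
    (hι : Fintype.card ι ≤ r) (hκ : N * r ≤ Fintype.card κ) :
    LinearIndependent K (Matrix.of fun (x : Fin N × ι) (c : κ) =>
      ∑ k : Fin r, (u x.2 * v c) ^ (k + r * x.1 : ℕ)).row := by
  rw [Fintype.linearIndependent_iff]
  intro x hx
  have h1 : (fun s : Fin (N * r) =>
      ∑ b, x ((finProdFinEquiv.symm s).1, b) * u b ^ (s : ℕ)) = 0 := by
    refine eq_zero_of_sum_fin_mul_pow_eq_zero hv hκ fun c => ?_
    have h2 := congrFun hx c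
    simp only [Finset.sum_apply, Pi.smul_apply, Matrix.row_apply, Matrix.of_apply, smul_eq_mul,
      Pi.zero_apply, Finset.mul_sum] at h2
    rw [← h2, ← finProdFinEquiv.sum_comp, Fintype.sum_prod_type, Fintype.sum_prod_type]
    refine Finset.sum_congr rfl fun j _ => ?_
    rw [Finset.sum_comm]
    refine Finset.sum_congr rfl fun k _ => ?_
    rw [Finset.sum_mul]
    refine Finset.sum_congr rfl fun b _ => ?_
    simp only [Equiv.symm_apply_apply, finProdFinEquiv_apply_val, mul_pow]
    ring
  rintro ⟨j, b⟩
  refine congrFun (eq_zero_of_sum_mul_pow_eq_zero (x := fun b => x (j, b)) hu hu0 (r * j) r hι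
    fun k hk => ?_) b
  have h2 := congrFun h1 (finProdFinEquiv (j, ⟨k, hk⟩))
  simpa [add_comm] using h2

end Vandermonde

/-- The value of the monomial with exponent `b` at the point whose coordinates are the first `m`
primes. By unique factorization, distinct monomials have distinct values there. -/
def primeWeight {m : ℕ} (b : Fin m →₀ ℕ) : ℕ := ∏ i : Fin m, Nat.nth Nat.Prime i ^ b i

theorem primeWeight_add {m : ℕ} (b c : Fin m →₀ ℕ) :
    primeWeight (b + c) = primeWeight b * primeWeight c := by
  simp [primeWeight, pow_add, Finset.prod_mul_distrib]

theorem primeWeight_ne_zero {m : ℕ} (b : Fin m →₀ ℕ) : primeWeight b ≠ 0 :=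
  Finset.prod_ne_zero_iff.mpr fun i _ => pow_ne_zero _ (Nat.prime_nth_prime i).ne_zero

theorem primeWeight_injective {m : ℕ} : Function.Injective (primeWeight (m := m)) := by
  intro b c h
  ext i
  have key (b : Fin m →₀ ℕ) : (primeWeight b).factorization (Nat.nth Nat.Prime i) = b i := by
    rw [primeWeight, Nat.factorization_prod (g := fun j : Fin m => Nat.nth Nat.Prime j ^ b j)
      fun j _ => pow_ne_zero _ (Nat.prime_nth_prime j).ne_zero, Finset.sum_apply']
    rw [Finset.sum_eq_single i]
    · simp
    · intro j _ hj
      have : Nat.nth Nat.Prime j ≠ Nat.nth Nat.Prime i := fun h =>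
        hj (Fin.ext (Nat.nth_injective Nat.infinite_setOfPred_prime h))
      simp [this]
    · simp
  rw [← key b, ← key c, h]

/-! ### Counting monomials -/

section Exponents

theorem card_degree_eq {m k : ℕ} (hm : 1 ≤ m) :
    Fintype.card {e : Fin m →₀ ℕ // e.degree = k} = (m + k - 1).choose (m - 1) := by
  have e : {e : Fin m →₀ ℕ // e.degree = k} ≃ Sym (Fin m) k :=
    (Equiv.subtypeEquivRight fun e => by
      rw [Finsupp.degree, Finsupp.sum]; rfl).trans (Sym.equivNatSum (Fin m) k).symm
  rw [Fintype.card_congr e, Sym.card_sym_eq_choose, Fintype.card_fin,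
    Nat.choose_symm_of_eq_add (show m + k - 1 = k + (m - 1) by omega)]

/-- The exponents of degree `i - 1`, none for `i = 0`. The condition `b.degree + 1 = i` avoids the
truncated subtraction, which would give `{0}` for `i = 0`. -/
instance fintypeDegreeAddOneEq (m i : ℕ) : Fintype {b : Fin m →₀ ℕ // b.degree + 1 = i} :=
  have : Finite {b : Fin m →₀ ℕ // b.degree + 1 = i} :=
    ((Finsupp.finite_of_degree_le (σ := Fin m) i).subset fun b hb => by
      simp only [Set.mem_ofPred_eq] at hb ⊢; omega : {b : Fin m →₀ ℕ | b.degree + 1 = i}.Finite)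
  Fintype.ofFinite _

theorem card_degree_add_one_eq {m i : ℕ} (hm : 2 ≤ m) :
    Fintype.card {b : Fin m →₀ ℕ // b.degree + 1 = i} = (m + i - 2).choose (m - 1) := by
  cases i with
  | zero =>
    rw [Nat.choose_eq_zero_of_lt (by omega), Fintype.card_eq_zero_iff]
    exact ⟨fun b => by simpa using b.2⟩
  | succ i =>
    have e : {b : Fin m →₀ ℕ // b.degree + 1 = i + 1} ≃ {b : Fin m →₀ ℕ // b.degree = i} :=
      Equiv.subtypeEquivRight fun b => by simp
    rw [Fintype.card_congr e, card_degree_eq (by omega)]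
    congr 1

/-- Each monomial of degree `i ≥ 1` is a variable times a monomial of degree `i - 1`. -/
theorem card_degree_eq_le_mul {m i : ℕ} (hi : 1 ≤ i) :
    Fintype.card {b : Fin m →₀ ℕ // b.degree = i} ≤
      m * Fintype.card {b : Fin m →₀ ℕ // b.degree + 1 = i} := by
  have h : Fintype.card (Fin m × {b : Fin m →₀ ℕ // b.degree + 1 = i}) =
      m * Fintype.card {b : Fin m →₀ ℕ // b.degree + 1 = i} := by simp
  rw [← h]
  refine Fintype.card_le_of_surjective
    (fun x => ⟨Finsupp.single x.1 1 + x.2.1, by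
      rw [map_add, Finsupp.degree_single, add_comm, x.2.2]⟩) ?_
  rintro ⟨e, he⟩
  have hne : e ≠ 0 := by
    rintro rfl
    simp at he
    omega
  obtain ⟨k, hk⟩ := Finsupp.ne_iff.mp hne
  have hle : Finsupp.single k 1 ≤ e := by
    rw [Finsupp.single_le_iff]
    exact Nat.one_le_iff_ne_zero.mpr hk
  have hadd := add_tsub_cancel_of_le hle
  refine ⟨⟨k, e - Finsupp.single k 1, ?_⟩, Subtype.ext hadd⟩
  have := congrArg Finsupp.degree hadd
  rw [map_add, Finsupp.degree_single] at this
  omega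

end Exponents

/-! ### The catalecticant matrices of `X_0 p_0 + ⋯ + X_n p_n + G` -/

section Assemble

variable {K : Type*} [Field K] {n m : ℕ}

/-- The monomial in the variables `U` with exponent `b`, as an exponent in all the variables. -/
def liftU (n : ℕ) {m : ℕ} (b : Fin m →₀ ℕ) : Fin (n + 1) ⊕ Fin m →₀ ℕ := b.mapDomain Sum.inr

theorem degree_liftU (b : Fin m →₀ ℕ) : (liftU n b).degree = b.degree :=
  Finsupp.degree_mapDomain _ _

theorem liftU_add (b c : Fin m →₀ ℕ) : liftU n (b + c) = liftU n b + liftU n c :=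
  Finsupp.mapDomain_add

theorem liftU_inl (b : Fin m →₀ ℕ) (j : Fin (n + 1)) : liftU n b (Sum.inl j) = 0 :=
  Finsupp.mapDomain_of_notMem_range _ _ (by simp)

theorem liftU_inr (b : Fin m →₀ ℕ) (k : Fin m) : liftU n b (Sum.inr k) = b k :=
  Finsupp.mapDomain_apply Sum.inr_injective _ _

/-- A monomial either involves only the variables `U` or is divisible by some `X_j`. -/
theorem eq_liftU_or (a : Fin (n + 1) ⊕ Fin m →₀ ℕ) :
    (∃ b, a = liftU n b) ∨ ∃ j a', a = Finsupp.single (Sum.inl j) 1 + a' := by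
  by_cases h : ∃ j, a (Sum.inl j) ≠ 0
  · obtain ⟨j, hj⟩ := h
    refine Or.inr ⟨j, a - Finsupp.single (Sum.inl j) 1, (add_tsub_cancel_of_le ?_).symm⟩
    rw [Finsupp.single_le_iff]
    exact Nat.one_le_iff_ne_zero.mpr hj
  · push Not at h
    refine Or.inl ⟨Finsupp.equivFunOnFinite.symm fun k => a (Sum.inr k), Finsupp.ext ?_⟩
    rintro (j | k)
    · rw [h, liftU_inl]
    · rw [liftU_inr]
      rfl

theorem dividedCoeff_rename_liftU (f : MvPolynomial (Fin m) K) (b : Fin m →₀ ℕ) :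
    dividedCoeff (rename Sum.inr f) (liftU n b) = dividedCoeff f b := by
  rw [dividedCoeff_apply, dividedCoeff_apply, Fintype.prod_sum_type]
  simp only [liftU_inl, liftU_inr]
  rw [liftU, coeff_rename_mapDomain _ Sum.inr_injective]
  simp

theorem dividedCoeff_rename_single_add (f : MvPolynomial (Fin m) K) (j : Fin (n + 1))
    (a : Fin (n + 1) ⊕ Fin m →₀ ℕ) :
    dividedCoeff (rename Sum.inr f) (Finsupp.single (Sum.inl j) 1 + a) = 0 := by
  rw [dividedCoeff_apply, coeff_rename_eq_zero, mul_zero]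
  intro u hu
  have h1 := DFunLike.congr_fun hu (Sum.inl j)
  rw [Finsupp.mapDomain_of_notMem_range _ _ (by simp)] at h1
  simp only [Finsupp.add_apply, Finsupp.single_eq_same] at h1
  omega

variable (p : Fin (n + 1) → MvPolynomial (Fin m) K) (G : MvPolynomial (Fin m) K)

theorem pderiv_assemble (j : Fin (n + 1)) :
    pderiv (Sum.inl j) (assemble p G) = rename Sum.inr (p j) := by
  classical
  have h (f : MvPolynomial (Fin m) K) :
      pderiv (Sum.inl j) (rename Sum.inr f : MvPolynomial (Fin (n + 1) ⊕ Fin m) K) = 0 :=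
    pderiv_eq_zero_of_notMem_vars fun hv => by
      simpa using vars_rename _ _ hv
  simp only [assemble, map_add, map_sum, Derivation.leibniz, h, pderiv_X, add_zero,
    smul_eq_mul]
  rw [Finset.sum_eq_single j]
  · simp
  · intro k _ hk
    simp [hk]
  · simp

theorem dividedCoeff_assemble_liftU (b : Fin m →₀ ℕ) :
    dividedCoeff (assemble p G) (liftU n b) = dividedCoeff G b := by
  rw [← dividedCoeff_rename_liftU (n := n), assemble, map_add, Pi.add_apply, add_eq_right, map_sum,
    Finset.sum_apply]
  refine Finset.sum_eq_zero fun j _ => ?_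
  rw [dividedCoeff_apply, coeff_X_mul', if_neg, mul_zero]
  simp [liftU_inl]

theorem dividedCoeff_assemble_single_add (j : Fin (n + 1)) (a : Fin (n + 1) ⊕ Fin m →₀ ℕ) :
    dividedCoeff (assemble p G) (Finsupp.single (Sum.inl j) 1 + a) =
      dividedCoeff (rename Sum.inr (p j)) a := by
  rw [← dividedCoeff_pderiv, pderiv_assemble]

theorem isHomogeneous_assemble {d : ℕ} (hd : 1 ≤ d) (hp : ∀ j, (p j).IsHomogeneous (d - 1))
    (hG : G.IsHomogeneous d) : (assemble p G).IsHomogeneous d := by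
  refine (IsHomogeneous.sum _ _ _ fun j _ => ?_).add hG.rename_isHomogeneous
  have := (isHomogeneous_X K (Sum.inl j : Fin (n + 1) ⊕ Fin m)).mul
    ((hp j).rename_isHomogeneous (f := Sum.inr))
  rwa [Nat.add_sub_cancel' hd] at this

/-- The monomials of degree `i` in the variables `U` alone. -/
def rowU (n : ℕ) {m : ℕ} (i : ℕ) (b : {b : Fin m →₀ ℕ // b.degree = i}) :
    {e : Fin (n + 1) ⊕ Fin m →₀ ℕ // e.degree = i} :=
  ⟨liftU n b.1, (degree_liftU _).trans b.2⟩

/-- The monomials of degree `i` that are linear in the variables `X`. -/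
def rowX {n m : ℕ} (i : ℕ) (x : Fin (n + 1) × {b : Fin m →₀ ℕ // b.degree + 1 = i}) :
    {e : Fin (n + 1) ⊕ Fin m →₀ ℕ // e.degree = i} :=
  ⟨Finsupp.single (Sum.inl x.1) 1 + liftU n x.2.1, by
    rw [map_add, Finsupp.degree_single, degree_liftU, add_comm, x.2.2]⟩

/-- As `F` is of degree at most one in the variables `X`, a row indexed by a monomial divisible by some
`X_j` vanishes unless that monomial is linear in `X`, and then it is supported on the monomials
in `U`. -/
theorem catalecticant_eq_zero_of_notMem_range {i j : ℕ}
    {e : {e : Fin (n + 1) ⊕ Fin m →₀ ℕ // e.degree = i}}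
    (heU : e ∉ Set.range (rowU n i)) (c : {e : Fin (n + 1) ⊕ Fin m →₀ ℕ // e.degree = j})
    (h : e ∉ Set.range (rowX i) ∨ c ∉ Set.range (rowU n j)) :
    catalecticant (assemble p G) i j e c = 0 := by
  obtain ⟨e, he⟩ := e
  obtain ⟨c, hc⟩ := c
  rw [catalecticant_apply]
  obtain ⟨b, rfl⟩ | ⟨k, a, rfl⟩ := eq_liftU_or e
  · exact absurd ⟨⟨b, (degree_liftU (n := n) b).symm.trans he⟩, rfl⟩ heU
  rw [add_assoc, dividedCoeff_assemble_single_add]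
  obtain ⟨b, rfl⟩ | ⟨l, a, rfl⟩ := eq_liftU_or a
  · have heX : (⟨_, he⟩ : {e : Fin (n + 1) ⊕ Fin m →₀ ℕ // e.degree = i}) ∈
        Set.range (rowX (n := n) (m := m) i) := by
      refine ⟨(k, ⟨b, ?_⟩), rfl⟩
      rwa [map_add, Finsupp.degree_single, degree_liftU, add_comm] at he
    obtain ⟨b', rfl⟩ | ⟨l, a, rfl⟩ := eq_liftU_or c
    · exact absurd ⟨⟨b', (degree_liftU (n := n) b').symm.trans hc⟩, rfl⟩
        (h.resolve_left fun h => h heX)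
    · rw [add_left_comm, dividedCoeff_rename_single_add]
  · rw [add_assoc, dividedCoeff_rename_single_add]

theorem rank_catalecticant_le (i j : ℕ) :
    (catalecticant (assemble p G) i j).rank ≤
      Fintype.card {b : Fin m →₀ ℕ // b.degree = i} +
        min (Fintype.card {b : Fin m →₀ ℕ // b.degree = j})
          ((n + 1) * Fintype.card {b : Fin m →₀ ℕ // b.degree + 1 = i}) := by
  classical
  set H := catalecticant (assemble p G) i j with hH
  let A : Matrix _ _ K := Matrix.of fun e c => if e ∈ Set.range (rowU n i) then H e c else 0
  let B : Matrix _ _ K := Matrix.of fun e c => if e ∈ Set.range (rowU n i) then 0 else H e c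
  have hAB : H = A + B := by
    ext e c
    simp only [A, B, Matrix.add_apply, Matrix.of_apply]
    split_ifs <;> simp
  rw [hAB]
  refine (rank_add_le A B).trans (add_le_add ?_ (le_min ?_ ?_))
  · refine rank_le_card_of_row_eq_zero A (rowU n i) fun e he => funext fun c => ?_
    exact if_neg he
  · rw [← Matrix.rank_transpose]
    refine rank_le_card_of_row_eq_zero _ (rowU n j) fun c hc => funext fun e => ?_
    change (if e ∈ Set.range (rowU n i) then 0 else H e c) = 0
    split_ifs with he
    · rfl
    · exact catalecticant_eq_zero_of_notMem_range p G he c (Or.inr hc)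
  · have h : (n + 1) * Fintype.card {b : Fin m →₀ ℕ // b.degree + 1 = i} =
        Fintype.card (Fin (n + 1) × {b : Fin m →₀ ℕ // b.degree + 1 = i}) := by simp
    rw [h]
    refine rank_le_card_of_row_eq_zero B (rowX i) fun e he' => funext fun c => ?_
    change (if e ∈ Set.range (rowU n i) then 0 else H e c) = 0
    split_ifs with he
    · rfl
    · exact catalecticant_eq_zero_of_notMem_range p G he c (Or.inl he')

/-- On the monomials of degree at most one in the variables `X`, the catalecticant matrix has the
block form `(* M; N 0)`, where `M` and `N` depend on `p_0, …, p_n` only. -/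
theorem rank_add_rank_le_rank_catalecticant (i j : ℕ) :
    (Matrix.of fun (b : {b : Fin m →₀ ℕ // b.degree = i})
        (x : Fin (n + 1) × {b : Fin m →₀ ℕ // b.degree + 1 = j}) =>
        dividedCoeff (p x.1) (b.1 + x.2.1)).rank +
      (Matrix.of fun (x : Fin (n + 1) × {b : Fin m →₀ ℕ // b.degree + 1 = i})
        (c : {b : Fin m →₀ ℕ // b.degree = j}) => dividedCoeff (p x.1) (x.2.1 + c.1)).rank ≤
      (catalecticant (assemble p G) i j).rank := by
  refine (rank_add_rank_le_rank_fromBlocks (catalecticant G i j) _ _).trans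
    (le_trans (le_of_eq ?_) (Matrix.rank_submatrix_le (catalecticant (assemble p G) i j)
      (Sum.elim (rowU n i) (rowX i)) (Sum.elim (rowU n j) (rowX j))))
  congr 1
  ext (b | x) (c | y)
  · simp only [Matrix.submatrix_apply, Sum.elim_inl, catalecticant_apply, rowU,
      Matrix.fromBlocks_apply₁₁, ← liftU_add, dividedCoeff_assemble_liftU]
  · simp only [Matrix.submatrix_apply, Sum.elim_inl, Sum.elim_inr, catalecticant_apply, rowU, rowX,
      Matrix.fromBlocks_apply₁₂, Matrix.of_apply]
    rw [add_left_comm, ← liftU_add, dividedCoeff_assemble_single_add, dividedCoeff_rename_liftU]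
  · simp only [Matrix.submatrix_apply, Sum.elim_inl, Sum.elim_inr, catalecticant_apply, rowU, rowX,
      Matrix.fromBlocks_apply₂₁, Matrix.of_apply]
    rw [add_assoc, ← liftU_add, dividedCoeff_assemble_single_add, dividedCoeff_rename_liftU]
  · simp only [Matrix.submatrix_apply, Sum.elim_inr, catalecticant_apply, rowX,
      Matrix.fromBlocks_apply₂₂, Matrix.zero_apply]
    rw [add_assoc, dividedCoeff_assemble_single_add, add_left_comm, dividedCoeff_rename_single_add]

end Assemble

/-! ### General forms -/

section General

variable {K : Type*} [Field K] {n m d : ℕ}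

theorem exists_coefficients_eq
    (v : (Fin (n + 1) × Exponents m (d - 1)) ⊕ Exponents m d → K) :
    ∃ (p : Fin (n + 1) → MvPolynomial (Fin m) K) (G : MvPolynomial (Fin m) K),
      (∀ j, (p j).IsHomogeneous (d - 1)) ∧ G.IsHomogeneous d ∧ coefficients d p G = v := by
  classical
  have key (k : ℕ) (u : Exponents m k → K) : ∃ f : MvPolynomial (Fin m) K,
      f.IsHomogeneous k ∧ ∀ a : Exponents m k, coeff a.1 f = u a := by
    refine ⟨∑ a, monomial a.1 (u a), IsHomogeneous.sum _ _ _ fun a _ =>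
      isHomogeneous_monomial _ a.2, fun a => ?_⟩
    simp [coeff_sum, coeff_monomial, ← Subtype.ext_iff]
  choose f hf hfc using key
  refine ⟨fun j => f (d - 1) fun a => v (Sum.inl (j, a)), f d fun a => v (Sum.inr a),
    fun j => hf _ _, hf _ _, ?_⟩
  ext (x | a)
  · exact hfc _ _ _
  · exact hfc _ _ _

variable {P Q : (Fin (n + 1) → MvPolynomial (Fin m) K) → MvPolynomial (Fin m) K → Prop}

theorem HoldsForGeneral.mono (h : HoldsForGeneral d P)
    (hPQ : ∀ p G, (∀ j, (p j).IsHomogeneous (d - 1)) → G.IsHomogeneous d → P p G → Q p G) :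
    HoldsForGeneral d Q := by
  obtain ⟨Φ, h0, h⟩ := h
  exact ⟨Φ, h0, fun p G hp hG hΦ => hPQ p G hp hG (h p G hp hG hΦ)⟩

theorem HoldsForGeneral.and (hP : HoldsForGeneral d P) (hQ : HoldsForGeneral d Q) :
    HoldsForGeneral d fun p G => P p G ∧ Q p G := by
  obtain ⟨Φ, h0, h⟩ := hP
  obtain ⟨Ψ, h0', h'⟩ := hQ
  refine ⟨Φ * Ψ, mul_ne_zero h0 h0', fun p G hp hG hΦ => ?_⟩
  rw [map_mul] at hΦ
  exact ⟨h p G hp hG (left_ne_zero_of_mul hΦ), h' p G hp hG (right_ne_zero_of_mul hΦ)⟩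

theorem HoldsForGeneral.forall_le
    {P : ℕ → (Fin (n + 1) → MvPolynomial (Fin m) K) → MvPolynomial (Fin m) K → Prop} (N : ℕ)
    (h : ∀ i ≤ N, HoldsForGeneral d (P i)) : HoldsForGeneral d fun p G => ∀ i ≤ N, P i p G := by
  induction N with
  | zero => exact (h 0 le_rfl).mono fun p G _ _ hP i hi => by rwa [Nat.le_zero.mp hi]
  | succ N ih =>
    refine ((ih fun i hi => h i (by omega)).and (h (N + 1) le_rfl)).mono ?_
    rintro p G - - ⟨h1, h2⟩ i hi
    obtain hi | rfl := Nat.le_succ_iff.mp hi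
    exacts [h1 i hi, h2]

theorem HoldsForGeneral.exists [Infinite K] (h : HoldsForGeneral d P) :
    ∃ p G, (∀ j, (p j).IsHomogeneous (d - 1)) ∧ G.IsHomogeneous d ∧ P p G := by
  obtain ⟨Φ, h0, h⟩ := h
  obtain ⟨v, hv⟩ : ∃ v, eval v Φ ≠ 0 := by
    by_contra! hv
    exact h0 (MvPolynomial.funext fun v => by rw [hv, map_zero])
  obtain ⟨p, G, hp, hG, rfl⟩ := exists_coefficients_eq v
  exact ⟨p, G, hp, hG, h p G hp hG hv⟩

/-- The function `f` of forms `p_0, …, p_n` of degree `d - 1` and `G` of degree `d` is polynomial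
in the coefficients of these forms. -/
def IsPolynomialFunction (d : ℕ)
    (f : (Fin (n + 1) → MvPolynomial (Fin m) K) → MvPolynomial (Fin m) K → K) : Prop :=
  ∃ Ψ : MvPolynomial ((Fin (n + 1) × Exponents m (d - 1)) ⊕ Exponents m d) K,
    ∀ p G, (∀ j, (p j).IsHomogeneous (d - 1)) → G.IsHomogeneous d →
      eval (coefficients d p G) Ψ = f p G

theorem holdsForGeneral_le_rank {R C : Type*} [Finite R] [Fintype C]
    (A : (Fin (n + 1) → MvPolynomial (Fin m) K) → MvPolynomial (Fin m) K → Matrix R C K)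
    (hA : ∀ x y, IsPolynomialFunction d fun p G => A p G x y) {k : ℕ}
    {p₀ : Fin (n + 1) → MvPolynomial (Fin m) K} {G₀ : MvPolynomial (Fin m) K}
    (hp₀ : ∀ j, (p₀ j).IsHomogeneous (d - 1)) (hG₀ : G₀.IsHomogeneous d)
    (hk : k ≤ (A p₀ G₀).rank) : HoldsForGeneral d fun p G => k ≤ (A p G).rank := by
  choose Ψ hΨ using hA
  have hmap (p G) (hp : ∀ j, (p j).IsHomogeneous (d - 1)) (hG : G.IsHomogeneous d) :
      (Matrix.of Ψ).map (eval (coefficients d p G)) = A p G := by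
    ext x y
    exact hΨ x y p G hp hG
  rw [← hmap p₀ G₀ hp₀ hG₀] at hk
  obtain ⟨Φ, h0, h⟩ := exists_ne_zero_forall_le_rank _ _ hk
  exact ⟨Φ, h0, fun p G hp hG hΦ => (h _ hΦ).trans_eq (by rw [hmap p G hp hG])⟩

theorem isPolynomialFunction_dividedCoeff (j : Fin (n + 1)) (a : Fin m →₀ ℕ) :
    IsPolynomialFunction (K := K) d fun p _ => dividedCoeff (p j) a := by
  by_cases ha : a.degree = d - 1
  · refine ⟨C ((∏ s, (a s).factorial : ℕ) : K) * X (Sum.inl (j, ⟨a, ha⟩)), fun p G _ _ => ?_⟩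
    rw [map_mul, eval_C, eval_X]
    rfl
  · exact ⟨0, fun p G hp _ => (map_zero _).trans
      (dividedCoeff_eq_zero_of_degree_ne (hp j) ha).symm⟩

theorem isPolynomialFunction_dividedCoeff_assemble (a : Fin (n + 1) ⊕ Fin m →₀ ℕ) :
    IsPolynomialFunction (K := K) d fun p G => dividedCoeff (assemble p G) a := by
  obtain ⟨b, rfl⟩ | ⟨j, a, rfl⟩ := eq_liftU_or a
  · simp only [dividedCoeff_assemble_liftU]
    by_cases hb : b.degree = d
    · refine ⟨C ((∏ s, (b s).factorial : ℕ) : K) * X (Sum.inr ⟨b, hb⟩), fun p G _ _ => ?_⟩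
      rw [map_mul, eval_C, eval_X]
      rfl
    · exact ⟨0, fun p G _ hG => (map_zero _).trans
        (dividedCoeff_eq_zero_of_degree_ne hG hb).symm⟩
  · simp only [dividedCoeff_assemble_single_add]
    obtain ⟨b, rfl⟩ | ⟨l, a, rfl⟩ := eq_liftU_or a
    · simp only [dividedCoeff_rename_liftU]
      exact isPolynomialFunction_dividedCoeff j b
    · simp only [dividedCoeff_rename_single_add]
      exact ⟨0, fun p G _ _ => map_zero _⟩

/-- Up to a scalar, the form `p_j` is `∑ k, L_{jk} ^ (d - 1)`, where the linear form `L_{jk}` has as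
coefficients the powers of exponent `k + r * j` of the first `m` primes. -/
theorem exists_dividedCoeff_eq_sum_pow [CharZero K] (n m d r : ℕ) :
    ∃ (p : Fin (n + 1) → MvPolynomial (Fin m) K) (G : MvPolynomial (Fin m) K),
      (∀ j, (p j).IsHomogeneous (d - 1)) ∧ G.IsHomogeneous d ∧
      ∀ j, ∀ a : Fin m →₀ ℕ, a.degree = d - 1 →
        dividedCoeff (p j) a = ∑ k : Fin r, (primeWeight a : K) ^ (k + r * j : ℕ) := by
  obtain ⟨p, G, hp, hG, h⟩ := exists_coefficients_eq (K := K) (n := n) (m := m) (d := d)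
    (Sum.elim (fun x => (∑ k : Fin r, (primeWeight x.2.1 : K) ^ (k + r * x.1 : ℕ)) /
      ((∏ s, (x.2.1 s).factorial : ℕ) : K)) 0)
  refine ⟨p, G, hp, hG, fun j a ha => ?_⟩
  have h1 := congrFun h (Sum.inl (j, ⟨a, ha⟩))
  simp only [coefficients, Sum.elim_inl] at h1
  rw [dividedCoeff_apply, h1, mul_div_cancel₀]
  exact_mod_cast Finset.prod_ne_zero_iff.mpr fun s _ => (a s).factorial_ne_zero

theorem cast_primeWeight_injective [CharZero K] {s : Set (Fin m →₀ ℕ)} :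
    Function.Injective fun b : s => (primeWeight b.1 : K) :=
  Nat.cast_injective.comp (primeWeight_injective.comp Subtype.val_injective)

theorem cast_primeWeight_ne_zero [CharZero K] (b : Fin m →₀ ℕ) : (primeWeight b : K) ≠ 0 :=
  Nat.cast_ne_zero.mpr (primeWeight_ne_zero b)

/-- For `i ≤ d / 2`, some choice of `p_0, …, p_n` and `G` attains the upper bound of
`rank_catalecticant_le`: the sums of powers of `exists_dividedCoeff_eq_sum_pow` make both
off-diagonal blocks of the catalecticant matrix products of Vandermonde matrices. -/
theorem exists_le_rank_catalecticant [CharZero K] (hm : 2 ≤ m) (hmn : m ≤ n) {i j : ℕ}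
    (hij : i + j = d) (hle : i ≤ j) (hd : 1 ≤ d) :
    ∃ (p : Fin (n + 1) → MvPolynomial (Fin m) K) (G : MvPolynomial (Fin m) K),
      (∀ j, (p j).IsHomogeneous (d - 1)) ∧ G.IsHomogeneous d ∧
      Fintype.card {b : Fin m →₀ ℕ // b.degree = i} +
        min (Fintype.card {b : Fin m →₀ ℕ // b.degree = j})
          ((n + 1) * Fintype.card {b : Fin m →₀ ℕ // b.degree + 1 = i}) ≤
        (catalecticant (assemble p G) i j).rank := by
  classical
  -- Each `p_j` needs one power for each monomial of degree `i - 1`, and for `i = 0` one power all the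
  -- same, as otherwise all `p_j` would vanish.
  set r := max 1 (Fintype.card {b : Fin m →₀ ℕ // b.degree + 1 = i}) with hr
  obtain ⟨p, G, hp, hG, h⟩ := exists_dividedCoeff_eq_sum_pow (K := K) n m d r
  refine ⟨p, G, hp, hG, le_trans (add_le_add ?_ ?_) (rank_add_rank_le_rank_catalecticant p G i j)⟩
  · have hM : (Matrix.of fun (b : {b : Fin m →₀ ℕ // b.degree = i})
        (x : Fin (n + 1) × {b : Fin m →₀ ℕ // b.degree + 1 = j}) =>
        dividedCoeff (p x.1) (b.1 + x.2.1)) = Matrix.of fun b x =>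
        ∑ k : Fin r, ((primeWeight b.1 : K) * (primeWeight x.2.1 : K)) ^ (k + r * x.1 : ℕ) := by
      ext b x
      have hb := b.2
      have hx := x.2.2
      rw [Matrix.of_apply, h _ _ (by rw [map_add]; omega), primeWeight_add]
      push_cast
      rfl
    rw [hM, LinearIndependent.rank_matrix]
    refine linearIndependent_sum_pow_left (u := fun b : {b : Fin m →₀ ℕ // b.degree = i} =>
      (primeWeight b.1 : K)) (v := fun c : {b : Fin m →₀ ℕ // b.degree + 1 = j} =>
      (primeWeight c.1 : K)) cast_primeWeight_injective
      (fun _ => cast_primeWeight_ne_zero _) cast_primeWeight_injective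
      (fun _ => cast_primeWeight_ne_zero _) ?_ ?_
    · obtain rfl | hi := Nat.eq_zero_or_pos i
      · rw [card_degree_eq (by omega), add_zero, Nat.choose_self]
        exact Nat.mul_pos (by omega) (by omega)
      · exact (card_degree_eq_le_mul hi).trans (Nat.mul_le_mul (by omega) (le_max_right _ _))
    · rw [hr, card_degree_add_one_eq hm, card_degree_add_one_eq hm]
      exact max_le (Nat.choose_pos (by omega)) (Nat.choose_le_choose _ (by omega))
  · obtain rfl | hi := Nat.eq_zero_or_pos i
    · rw [card_degree_add_one_eq hm, Nat.choose_eq_zero_of_lt (by omega : m + 0 - 2 < m - 1)]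
      simp
    have hr' : r = Fintype.card {b : Fin m →₀ ℕ // b.degree + 1 = i} := by
      refine max_eq_right ?_
      rw [card_degree_add_one_eq hm]
      exact Nat.choose_pos (by omega)
    have hN : (Matrix.of fun (x : Fin (n + 1) × {b : Fin m →₀ ℕ // b.degree + 1 = i})
        (c : {b : Fin m →₀ ℕ // b.degree = j}) => dividedCoeff (p x.1) (x.2.1 + c.1)) =
        Matrix.of fun x c =>
        ∑ k : Fin r, ((primeWeight x.2.1 : K) * (primeWeight c.1 : K)) ^ (k + r * x.1 : ℕ) := by
      ext x c
      have hc := c.2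
      have hx := x.2.2
      rw [Matrix.of_apply, h _ _ (by rw [map_add]; omega), primeWeight_add]
      push_cast
      rfl
    rw [hN]
    obtain hcase | hcase := le_total ((n + 1) * r) (Fintype.card {b : Fin m →₀ ℕ // b.degree = j})
    · rw [LinearIndependent.rank_matrix]
      · simp
      refine linearIndependent_sum_pow_right (u := fun b : {b : Fin m →₀ ℕ // b.degree + 1 = i} =>
        (primeWeight b.1 : K)) (v := fun c : {b : Fin m →₀ ℕ // b.degree = j} =>
        (primeWeight c.1 : K)) cast_primeWeight_injective
        (fun _ => cast_primeWeight_ne_zero _) cast_primeWeight_injective hr'.ge hcase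
    · rw [← Matrix.rank_transpose, LinearIndependent.rank_matrix]
      · exact min_le_left _ _
      have hT : (Matrix.of fun (x : Fin (n + 1) × {b : Fin m →₀ ℕ // b.degree + 1 = i})
          (c : {b : Fin m →₀ ℕ // b.degree = j}) =>
          ∑ k : Fin r, ((primeWeight x.2.1 : K) * (primeWeight c.1 : K)) ^
            (k + r * x.1 : ℕ)).transpose = Matrix.of fun c x =>
          ∑ k : Fin r, ((primeWeight c.1 : K) * (primeWeight x.2.1 : K)) ^ (k + r * x.1 : ℕ) := by
        ext c x
        simp [mul_comm]
      rw [hT]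
      exact linearIndependent_sum_pow_left (u := fun c : {b : Fin m →₀ ℕ // b.degree = j} =>
        (primeWeight c.1 : K)) (v := fun b : {b : Fin m →₀ ℕ // b.degree + 1 = i} =>
        (primeWeight b.1 : K)) cast_primeWeight_injective
        (fun _ => cast_primeWeight_ne_zero _) cast_primeWeight_injective
        (fun _ => cast_primeWeight_ne_zero _) hcase hr'.le

theorem holdsForGeneral_linearIndependent [CharZero K]
    (hd : n + 1 ≤ Fintype.card {b : Fin m →₀ ℕ // b.degree = d - 1}) :
    HoldsForGeneral (K := K) (n := n) (m := m) d fun p _ => LinearIndependent K p := by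
  obtain ⟨p₀, G₀, hp₀, hG₀, h⟩ := exists_dividedCoeff_eq_sum_pow (K := K) n m d 1
  let A (p : Fin (n + 1) → MvPolynomial (Fin m) K) (_ : MvPolynomial (Fin m) K) :
      Matrix (Fin (n + 1)) {b : Fin m →₀ ℕ // b.degree = d - 1} K :=
    Matrix.of fun j c => dividedCoeff (p j) c.1
  have hA : n + 1 ≤ (A p₀ G₀).rank := by
    rw [LinearIndependent.rank_matrix]
    · simp
    -- With a single power in each `p_j` the coefficients form a Vandermonde matrix in the nodes
    -- `primeWeight c`.
    have hli := linearIndependent_sum_pow_right (N := n + 1) (r := 1) (ι := Unit)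
      (u := fun _ => (1 : K)) (v := fun c : {b : Fin m →₀ ℕ // b.degree = d - 1} =>
      (primeWeight c.1 : K)) (Function.injective_of_subsingleton _)
      (fun _ => one_ne_zero) cast_primeWeight_injective (by simp) (by simpa using hd)
    convert hli.comp (fun j => (j, ())) (fun a b hab => congrArg Prod.fst hab) using 1
    ext j c
    simpa [A] using h j c.1 c.2
  refine (holdsForGeneral_le_rank A (fun j c => isPolynomialFunction_dividedCoeff j c.1)
    hp₀ hG₀ hA).mono fun p G _ _ hr => ?_
  have hrows : LinearIndependent K (A p G).row := by
    rw [linearIndependent_iff_card_le_finrank_span, Set.finrank,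
      ← Matrix.rank_eq_finrank_span_row, Fintype.card_fin]
    exact hr
  exact LinearIndependent.of_comp (LinearMap.funLeft K K Subtype.val ∘ₗ dividedCoeff) hrows

/-- The `n + 1` elements outnumber the transcendence degree `m`. -/
theorem not_algebraicIndependent (hmn : m ≤ n) (p : Fin (n + 1) → MvPolynomial (Fin m) K) :
    ¬ AlgebraicIndependent K p := by
  intro h
  have := h.lift_cardinalMk_le_trdeg
  rw [MvPolynomial.trdeg_of_isDomain] at this
  simp only [Cardinal.mk_fin, Cardinal.lift_natCast, Nat.cast_le] at this
  omega

/-- For `i ≤ d / 2`, the number `hMax n m d i` is the upper bound of `rank_catalecticant_le`. -/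
theorem hMax_eq (hm : 2 ≤ m) {i j : ℕ} (hij : i + j = d) (hle : i ≤ j) :
    hMax n m d i = Fintype.card {b : Fin m →₀ ℕ // b.degree = i} +
        min (Fintype.card {b : Fin m →₀ ℕ // b.degree = j})
          ((n + 1) * Fintype.card {b : Fin m →₀ ℕ // b.degree + 1 = i}) := by
  rw [card_degree_eq (by omega), card_degree_eq (by omega), card_degree_add_one_eq hm, hMax,
    if_pos (by omega), ← Nat.add_min_add_left, alpha, beta, gamma]
  congr 4
  omega

theorem hMax_symm {i j : ℕ} (hij : i + j = d) : hMax n m d i = hMax n m d j := by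
  have key {i j : ℕ} (hij : i + j = d) (hle : i ≤ j) : hMax n m d i = hMax n m d j := by
    obtain rfl | hlt := hle.eq_or_lt
    · rfl
    · rw [hMax, hMax, if_pos (by omega), if_neg (by omega), if_pos (by omega),
        show d - j = i by omega]
  obtain hle | hle := le_total i j
  · exact key hij hle
  · exact (key ((add_comm j i).trans hij) hle).symm

theorem hVector_assemble_le [CharZero K] (hm : 2 ≤ m) (hd : 1 ≤ d)
    {p : Fin (n + 1) → MvPolynomial (Fin m) K} {G : MvPolynomial (Fin m) K}
    (hp : ∀ j, (p j).IsHomogeneous (d - 1)) (hG : G.IsHomogeneous d) :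
    hVector (assemble p G) ≤ hMax n m d := by
  have hF := isHomogeneous_assemble p G hd hp hG
  have key {i j : ℕ} (hij : i + j = d) (hle : i ≤ j) :
      hVector (assemble p G) i ≤ hMax n m d i := by
    rw [hVector_eq_rank hF hij, hMax_eq hm hij hle]
    exact rank_catalecticant_le p G i j
  intro i
  obtain hi | hi := lt_or_ge d i
  · rw [hVector_eq_zero hF hi]
    exact Nat.zero_le _
  obtain ⟨j, hij⟩ := Nat.exists_eq_add_of_le hi
  obtain hle | hle := le_total i j
  · exact key hij.symm hle
  · rw [hVector_symm hF hij.symm, hMax_symm hij.symm]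
    exact key (by omega) hle

/-- The bound of `hVector_assemble_le` is attained for general `p_0, …, p_n` and `G`. A different
example may be used for each degree `i ≤ d / 2`, because finitely many nonempty Zariski open subsets
of an affine space have a common point. -/
theorem holdsForGeneral_hVector_eq [CharZero K] (hm : 2 ≤ m) (hmn : m ≤ n) (hd : 1 ≤ d) :
    HoldsForGeneral (K := K) (n := n) (m := m) d fun p G =>
      hVector (assemble p G) = hMax n m d := by
  have key (i : ℕ) (hi : i ≤ d / 2) : HoldsForGeneral (K := K) (n := n) (m := m) d fun p G =>
      hMax n m d i ≤ (catalecticant (assemble p G) i (d - i)).rank := by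
    obtain ⟨p, G, hp, hG, h⟩ := exists_le_rank_catalecticant (K := K) hm hmn
      (show i + (d - i) = d by omega) (by omega) hd
    rw [← hMax_eq hm (show i + (d - i) = d by omega) (by omega)] at h
    exact holdsForGeneral_le_rank (fun p G => catalecticant (assemble p G) i (d - i))
      (fun e c => isPolynomialFunction_dividedCoeff_assemble (e.1 + c.1)) hp hG h
  refine (HoldsForGeneral.forall_le (d / 2) key).mono fun p G hp hG h => ?_
  have hF := isHomogeneous_assemble p G hd hp hG
  refine le_antisymm (hVector_assemble_le hm hd hp hG) fun i => ?_
  obtain hi | hi := lt_or_ge d i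
  · rw [hMax, if_neg (by omega), if_neg (by omega)]
    exact Nat.zero_le _
  have key' {i : ℕ} (hi : i ≤ d / 2) : hMax n m d i ≤ hVector (assemble p G) i := by
    rw [hVector_eq_rank hF (show i + (d - i) = d by omega)]
    exact h i hi
  obtain hle | hlt := le_or_gt i (d / 2)
  · exact key' hle
  · rw [hVector_symm hF (show i + (d - i) = d by omega),
      hMax_symm (show i + (d - i) = d by omega)]
    exact key' (by omega)

end General

end Perazzo

end

theorem proposition3p3 {K : Type*} [Field K] [IsAlgClosed K] [CharZero K] (n m d : ℕ)
    (hm : 2 ≤ m) (hnm : m ≤ n) (hd : n + 1 ≤ (d + m - 2).choose (m - 1)) :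
    IsGreatest
      {h : ℕ → ℕ | ∃ F : MvPolynomial (Fin (n + 1) ⊕ Fin m) K,
        Perazzo.IsPerazzoForm d F ∧ h = Perazzo.hVector F}
      (Perazzo.hMax n m d) ∧
    Perazzo.HoldsForGeneral d
      (fun (p : Fin (n + 1) → MvPolynomial (Fin m) K) (G : MvPolynomial (Fin m) K) =>
        Perazzo.IsPerazzoForm d (Perazzo.assemble p G) ∧
        Perazzo.hVector (Perazzo.assemble p G) = Perazzo.hMax n m d) := by
  have hd1 : 1 ≤ d := by
    by_contra h
    rw [Nat.choose_eq_zero_of_lt (by omega)] at hd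
    omega
  have hcard : n + 1 ≤ Fintype.card {b : Fin m →₀ ℕ // b.degree = d - 1} := by
    rwa [Perazzo.card_degree_eq (by omega), show m + (d - 1) - 1 = d + m - 2 by omega]
  have hgen : Perazzo.HoldsForGeneral d
      (fun (p : Fin (n + 1) → MvPolynomial (Fin m) K) (G : MvPolynomial (Fin m) K) =>
        Perazzo.IsPerazzoForm d (Perazzo.assemble p G) ∧
        Perazzo.hVector (Perazzo.assemble p G) = Perazzo.hMax n m d) :=
    ((Perazzo.holdsForGeneral_linearIndependent hcard).and
      (Perazzo.holdsForGeneral_hVector_eq hm hnm hd1)).mono fun p G hp hG h =>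
        ⟨⟨p, G, hp, hG, h.1, Perazzo.not_algebraicIndependent hnm p, rfl⟩, h.2⟩
  refine ⟨⟨?_, ?_⟩, hgen⟩
  · obtain ⟨p, G, -, -, hF, hh⟩ := hgen.exists
    exact ⟨_, hF, hh.symm⟩
  · rintro _ ⟨_, ⟨p, G, hp, hG, -, -, rfl⟩, rfl⟩
    exact Perazzo.hVector_assemble_le hm hd1 hp hG
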